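/- For $x\in\mathbf R^d$ let $x^\downarrow$ denote the decreasing rearrangement of the coordinates of $x$. For $x,y\in\mathbf R^D$ write $x\prec_w y$ ($x$ is submajorized by $y$) if $\sum_{i=1}^k x^\downarrow_i\le\sum_{i=1}^k y^\downarrow_i$ for every $k\in\{1,\dots,D\}$. For $x\in\mathbf R^d$ and $n\ge 1$ let $x^{\otimes n}\in\mathbf R^{d^n}$ be the vector with coordinates $x_{i_1}x_{i_2}\cdots x_{i_n}$, $(i_1,\dots,i_n)\in\{1,\dots,d\}^n$ (in any order). Let $x,y\in\mathbf R^d$ have nonnegative coordinates, and assume that the strict inequality $\|x\|_p<\|y\|_p$ between $\ell_p$ norms holds for every $1\le p\le\infty$ (including $p=\infty$). Then there exists an integer $n\ge 1$ such that $x^{\otimes N}\prec_w y^{\otimes N}$ for every integer $N\ge n$; in particular $x^{\otimes n}\prec_w y^{\otimes n}$. -/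

import Mathlib

open scoped ENNReal

/-- The decreasing rearrangement `x↓` of a finite real vector: the list of its coordinates,
with multiplicity, in non-increasing order. The index type is an arbitrary finite type, as
the order of the coordinates is immaterial. -/
noncomputable def decreasingRearrangement {ι : Type*} [Fintype ι] (x : ι → ℝ) : List ℝ :=
  (Finset.univ.val.map x).sort (· ≥ ·)

/-- Submajorization `x ≺_w y` of two real vectors of the same dimension `D`: for each
`k ∈ {1, …, D}`, the sum of the `k` largest coordinates of `x` is at most the sum of the `k`
largest coordinates of `y`. -/
def Submajorized {ι : Type*} [Fintype ι] (x y : ι → ℝ) : Prop :=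
  ∀ k ∈ Finset.Icc 1 (Fintype.card ι),
    ((decreasingRearrangement x).take k).sum ≤ ((decreasingRearrangement y).take k).sum

/-- The tensor power `x^{⊗n}` of a vector `x ∈ ℝ^d`: the vector of dimension `d ^ n` whose
coordinates are the products `x (i 0) * ⋯ * x (i (n - 1))`, indexed by the tuples `i` in
`{0, …, d - 1}^n`. -/
def tensorPower {d : ℕ} (x : Fin d → ℝ) (n : ℕ) : (Fin n → Fin d) → ℝ :=
  fun i => ∏ j, x (i j)

/-! ### Submajorization through truncated sums -/

/-! Submajorization follows from comparing the truncated sums `∑ (· - t)₊` for all `t ≥ 0`. For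
tensor powers and `t = exp (N a)` this is a Cramér-type large deviation estimate. Markov's
inequality bounds the sum for `x` by `(∑ x ^ p) ^ N * t ^ (1 - p)` for every `p ≥ 1`. For `y`, tilt
by the weights `y ^ p`, with `p` chosen so that the tilted mean of `log y` lies slightly above `a`;
by Chernoff's bound the typical tuples already give nearly the Markov value
(`le_sum_posPart_tensorPower`). Compactness in `p`, together with the strict inequality at `p = ∞`,
yields a gap `exp (-δ p)` between power sums (`exists_uniform_gap`). Its `N`-th power absorbs all
losses once `N` exceeds a threshold that does not depend on `t`. -/

theorem List.sum_take_le_mul_add_sum_posPart (l : List ℝ) (k : ℕ) {t : ℝ} (ht : 0 ≤ t) :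
    (l.take k).sum ≤ k * t + (l.map fun a => max (a - t) 0).sum := by
  induction l generalizing k with
  | nil => simpa using by positivity
  | cons a l ih =>
    cases k with
    | zero =>
      have h : 0 ≤ ((a :: l).map fun a => max (a - t) 0).sum :=
        List.sum_nonneg fun b hb => by
          obtain ⟨c, -, rfl⟩ := List.mem_map.1 hb
          exact le_max_right _ _
      simpa using h
    | succ k =>
      have h₁ := ih k
      have h₂ := le_max_left (a - t) 0
      simp only [List.take_succ_cons, List.sum_cons, List.map_cons, Nat.cast_add, Nat.cast_one]
      linarith

/-- The witness is the `k`-th entry: earlier entries are at least `t`, later ones have no excess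
over it. -/
theorem List.exists_sum_take_eq_mul_add_sum_posPart {l : List ℝ} (hl : l.Pairwise (· ≥ ·))
    {k : ℕ} (hk : 1 ≤ k) (hkl : k ≤ l.length) :
    ∃ t ∈ l, (l.take k).sum = k * t + (l.map fun a => max (a - t) 0).sum := by
  induction l generalizing k with
  | nil => simp at hkl; omega
  | cons a l ih =>
    rw [List.pairwise_cons] at hl
    obtain rfl | ⟨k, rfl⟩ : k = 1 ∨ ∃ m, k = m + 2 := by
      rcases k with _ | _ | k
      · omega
      · exact Or.inl rfl
      · exact Or.inr ⟨k, rfl⟩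
    · refine ⟨a, by simp, ?_⟩
      have h : (l.map fun b => max (b - a) 0).sum = 0 := by
        apply List.sum_eq_zero
        intro c hc
        obtain ⟨b, hb, rfl⟩ := List.mem_map.1 hc
        exact max_eq_right (sub_nonpos.2 (hl.1 b hb))
      simp [h]
    · obtain ⟨t, ht, h⟩ := ih hl.2 (k := k + 1) (by omega) (by simpa using hkl)
      refine ⟨t, List.mem_cons_of_mem _ ht, ?_⟩
      have hat : max (a - t) 0 = a - t := max_eq_left (sub_nonneg.2 (hl.1 t ht))
      rw [List.take_succ_cons, List.sum_cons, h, List.map_cons, List.sum_cons, hat]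
      push_cast
      ring

theorem sum_map_decreasingRearrangement {ι : Type*} [Fintype ι] (x : ι → ℝ) (f : ℝ → ℝ) :
    ((decreasingRearrangement x).map f).sum = ∑ i, f (x i) := by
  have h : ((decreasingRearrangement x : Multiset ℝ).map f).sum = ∑ i, f (x i) := by
    rw [decreasingRearrangement, Multiset.sort_eq, Multiset.map_map]
    rfl
  simpa using h

theorem mem_decreasingRearrangement {ι : Type*} [Fintype ι] {x : ι → ℝ} {t : ℝ} :
    t ∈ decreasingRearrangement x ↔ ∃ i, x i = t := by
  simp [decreasingRearrangement]

/-- The sum of the `k` largest coordinates is the minimum over `t` of `k t + ∑ (· - t)₊`. Use the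
minimizer for `y`, a coordinate of `y` and so nonnegative, as a competitor for `x`. -/
theorem submajorized_of_sum_posPart_le {ι : Type*} [Fintype ι] {x y : ι → ℝ}
    (hy : ∀ i, 0 ≤ y i)
    (h : ∀ t, 0 ≤ t → ∑ i, max (x i - t) 0 ≤ ∑ i, max (y i - t) 0) : Submajorized x y := by
  intro k hk
  rw [Finset.mem_Icc] at hk
  have hlen : (decreasingRearrangement y).length = Fintype.card ι := by
    simp [decreasingRearrangement]
  obtain ⟨t, ht, hty⟩ := List.exists_sum_take_eq_mul_add_sum_posPart
    (l := decreasingRearrangement y) (Multiset.pairwise_sort _ _) hk.1 (hlen ▸ hk.2)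
  have ht0 : 0 ≤ t := by
    obtain ⟨i, rfl⟩ := mem_decreasingRearrangement.1 ht
    exact hy i
  have hx := List.sum_take_le_mul_add_sum_posPart (decreasingRearrangement x) k ht0
  rw [sum_map_decreasingRearrangement x fun a => max (a - t) 0] at hx
  rw [sum_map_decreasingRearrangement y fun a => max (a - t) 0] at hty
  linarith [h t ht0]

/-! ### Tensor powers -/

section TensorPower

variable {d : ℕ}

theorem tensorPower_nonneg {x : Fin d → ℝ} (hx : ∀ i, 0 ≤ x i) (n : ℕ) (i : Fin n → Fin d) :
    0 ≤ tensorPower x n i :=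
  Finset.prod_nonneg fun j _ => hx (i j)

theorem tensorPower_rpow {x : Fin d → ℝ} (hx : ∀ i, 0 ≤ x i) (n : ℕ) (p : ℝ)
    (i : Fin n → Fin d) : tensorPower x n i ^ p = ∏ j, x (i j) ^ p :=
  (Real.finsetProd_rpow _ _ (fun j _ => hx (i j)) p).symm

theorem sum_tensorPower_rpow {x : Fin d → ℝ} (hx : ∀ i, 0 ≤ x i) (n : ℕ) (p : ℝ) :
    ∑ i, tensorPower x n i ^ p = (∑ i, x i ^ p) ^ n := by
  simp_rw [tensorPower_rpow hx]
  exact (Fintype.sum_pow (fun i => x i ^ p) n).symm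

theorem tensorPower_eq_exp {x : Fin d → ℝ} {n : ℕ} {i : Fin n → Fin d}
    (h : ∀ j, 0 < x (i j)) : tensorPower x n i = Real.exp (∑ j, Real.log (x (i j))) := by
  rw [Real.exp_sum]
  exact Finset.prod_congr rfl fun j _ => (Real.exp_log (h j)).symm

/-- Markov's inequality for the truncated sums of a tensor power. -/
theorem sum_posPart_tensorPower_le {x : Fin d → ℝ} (hx : ∀ i, 0 ≤ x i) (n : ℕ) {p t : ℝ}
    (hp : 1 ≤ p) (ht : 0 < t) :
    ∑ i, max (tensorPower x n i - t) 0 ≤ (∑ i, x i ^ p) ^ n * t ^ (1 - p) := by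
  rw [← sum_tensorPower_rpow hx, Finset.sum_mul]
  refine Finset.sum_le_sum fun i _ => ?_
  set u := tensorPower x n i
  have hu : 0 ≤ u := tensorPower_nonneg hx n i
  rcases le_or_gt u t with h | h
  · rw [max_eq_right (by linarith)]
    positivity
  · rw [max_eq_left (by linarith)]
    have hu' : 0 < u := ht.trans h
    have h₁ : u ^ (1 - p) ≤ t ^ (1 - p) :=
      Real.rpow_le_rpow_of_nonpos ht h.le (by linarith)
    calc u - t ≤ u := by linarith
      _ = u ^ p * u ^ (1 - p) := by rw [← Real.rpow_add hu']; simp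
      _ ≤ _ := by gcongr

end TensorPower

/-! ### Concentration of sums under product weights -/

section Concentration

variable {ι : Type*} [Fintype ι]

/-- Use `exp u ≤ 1 + u + u ^ 2` for `|u| ≤ 1`; centring kills the linear term. -/
theorem sum_mul_exp_le {w f : ι → ℝ} (hw : ∀ i, 0 ≤ w i) (hwf : ∑ i, w i * f i = 0) {R : ℝ}
    (hf : ∀ i, |f i| ≤ R) {s : ℝ} (hs : |s| * R ≤ 1) :
    ∑ i, w i * Real.exp (s * f i) ≤ (∑ i, w i) * Real.exp (s ^ 2 * R ^ 2) := by
  have key : ∀ i, w i * Real.exp (s * f i) ≤ w i * (1 + s ^ 2 * R ^ 2) + s * (w i * f i) := by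
    intro i
    have h₁ : |s * f i| ≤ |s| * R := by
      rw [abs_mul]
      exact mul_le_mul_of_nonneg_left (hf i) (abs_nonneg s)
    have h₂ := (abs_le.1 (Real.abs_exp_sub_one_sub_id_le (h₁.trans hs))).2
    have h₃ : (s * f i) ^ 2 ≤ s ^ 2 * R ^ 2 := by
      rw [← sq_abs, ← sq_abs s, ← mul_pow]
      exact pow_le_pow_left₀ (abs_nonneg _) h₁ 2
    have h₄ : Real.exp (s * f i) ≤ 1 + s ^ 2 * R ^ 2 + s * f i := by linarith
    calc w i * Real.exp (s * f i) ≤ w i * (1 + s ^ 2 * R ^ 2 + s * f i) :=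
          mul_le_mul_of_nonneg_left h₄ (hw i)
      _ = _ := by ring
  calc ∑ i, w i * Real.exp (s * f i)
      ≤ ∑ i, (w i * (1 + s ^ 2 * R ^ 2) + s * (w i * f i)) :=
        Finset.sum_le_sum fun i _ => key i
    _ = (∑ i, w i) * (1 + s ^ 2 * R ^ 2) := by
        rw [Finset.sum_add_distrib, ← Finset.sum_mul, ← Finset.mul_sum, hwf, mul_zero, add_zero]
    _ ≤ _ := by
        refine mul_le_mul_of_nonneg_left ?_ (Finset.sum_nonneg fun i _ => hw i)
        linarith [Real.add_one_le_exp (s ^ 2 * R ^ 2)]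

/-- Chernoff's bound for the upper tail of a sum of centred bounded functions under product
weights. -/
theorem sum_prod_filter_lt_le {w f : ι → ℝ} (hw : ∀ i, 0 ≤ w i) (hwf : ∑ i, w i * f i = 0)
    {R : ℝ} (hR : 0 < R) (hf : ∀ i, |f i| ≤ R) {c : ℝ} (hc : 0 < c) (hcR : c ≤ R) (n : ℕ) :
    ∑ i : Fin n → ι with n * c < ∑ j, f (i j), ∏ j, w (i j) ≤
      (∑ i, w i) ^ n * Real.exp (-(n * (c ^ 2 / (4 * R ^ 2)))) := by
  -- This minimizes the exponent `s ^ 2 * R ^ 2 - s * c`.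
  set s := c / (2 * R ^ 2) with hsdef
  have hs0 : 0 < s := by positivity
  have hs : |s| * R ≤ 1 := by
    rw [abs_of_pos hs0, hsdef]
    field_simp
    linarith
  have h₁ : ∀ i : Fin n → ι, ∏ j, w (i j) * Real.exp (s * f (i j)) =
      (∏ j, w (i j)) * Real.exp (s * ∑ j, f (i j)) := by
    intro i
    rw [Finset.prod_mul_distrib, ← Real.exp_sum, Finset.mul_sum]
  have h₂ : (∑ i : Fin n → ι with n * c < ∑ j, f (i j), ∏ j, w (i j)) * Real.exp (s * (n * c)) ≤
      ((∑ i, w i) * Real.exp (s ^ 2 * R ^ 2)) ^ n := by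
    calc _ = ∑ i : Fin n → ι with n * c < ∑ j, f (i j),
          (∏ j, w (i j)) * Real.exp (s * (n * c)) := Finset.sum_mul _ _ _
      _ ≤ ∑ i : Fin n → ι with n * c < ∑ j, f (i j), ∏ j, w (i j) * Real.exp (s * f (i j)) := by
          refine Finset.sum_le_sum fun i hi => ?_
          rw [h₁]
          refine mul_le_mul_of_nonneg_left ?_ (Finset.prod_nonneg fun j _ => hw _)
          exact Real.exp_le_exp.2 (mul_le_mul_of_nonneg_left (Finset.mem_filter.1 hi).2.le hs0.le)
      _ ≤ ∑ i : Fin n → ι, ∏ j, w (i j) * Real.exp (s * f (i j)) :=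
          Finset.sum_le_univ_sum_of_nonneg fun i =>
            Finset.prod_nonneg fun j _ => mul_nonneg (hw _) (Real.exp_pos _).le
      _ = (∑ i, w i * Real.exp (s * f i)) ^ n :=
          (Fintype.sum_pow (fun i => w i * Real.exp (s * f i)) n).symm
      _ ≤ _ := pow_le_pow_left₀
          (Finset.sum_nonneg fun i _ => mul_nonneg (hw _) (Real.exp_pos _).le)
          (sum_mul_exp_le hw hwf hf hs) n
  rw [← le_div_iff₀ (Real.exp_pos _), mul_pow, mul_div_assoc, ← Real.exp_nat_mul,
    ← Real.exp_sub] at h₂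
  have h₃ : n * (s ^ 2 * R ^ 2) - s * (n * c) = -(n * (c ^ 2 / (4 * R ^ 2))) := by
    rw [hsdef]
    field_simp
    ring
  rwa [h₃] at h₂

/-- Product weights concentrate on the tuples along which a centred bounded function has a small
mean. -/
theorem half_le_sum_prod_filter_abs_le {w f : ι → ℝ} (hw : ∀ i, 0 ≤ w i)
    (hwf : ∑ i, w i * f i = 0) {R : ℝ} (hR : 0 < R) (hf : ∀ i, |f i| ≤ R) {c : ℝ} (hc : 0 < c)
    (hcR : c ≤ R) {n : ℕ} (hn : Real.log 4 ≤ n * (c ^ 2 / (4 * R ^ 2))) :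
    (∑ i, w i) ^ n / 2 ≤
      ∑ i : Fin n → ι with |∑ j, f (i j)| ≤ n * c, ∏ j, w (i j) := by
  classical
  have hW : 0 ≤ (∑ i, w i) ^ n := pow_nonneg (Finset.sum_nonneg fun i _ => hw i) n
  have he : Real.exp (-(n * (c ^ 2 / (4 * R ^ 2)))) ≤ 1 / 4 := by
    rw [Real.exp_neg, one_div]
    refine inv_anti₀ (by norm_num) ?_
    rwa [← Real.log_le_iff_le_exp (by norm_num)]
  have hup := (sum_prod_filter_lt_le hw hwf hR hf hc hcR n).trans
    (mul_le_mul_of_nonneg_left he hW)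
  have hlo := (sum_prod_filter_lt_le (f := fun i => -f i) hw (by simp [hwf]) hR
    (by simpa using hf) hc hcR n).trans (mul_le_mul_of_nonneg_left he hW)
  have hp : ∀ i : Fin n → ι, 0 ≤ ∏ j, w (i j) := fun i => Finset.prod_nonneg fun j _ => hw _
  have hsum : (∑ i, w i) ^ n ≤
      (∑ i : Fin n → ι with |∑ j, f (i j)| ≤ n * c, ∏ j, w (i j)) +
      ((∑ i : Fin n → ι with n * c < ∑ j, f (i j), ∏ j, w (i j)) +
        ∑ i : Fin n → ι with n * c < ∑ j, -f (i j), ∏ j, w (i j)) := by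
    rw [Fintype.sum_pow]
    simp only [Finset.sum_filter, ← Finset.sum_add_distrib]
    refine Finset.sum_le_sum fun i _ => ?_
    have h0 := hp i
    rw [Finset.sum_neg_distrib]
    split_ifs with h₁ h₂ h₃ h₂ h₃ <;> try linarith
    exact absurd (abs_le.2 ⟨by linarith, by linarith⟩) h₁
  linarith

end Concentration

/-! ### Lower bound for the truncated sums of a tensor power -/

section LowerBound

variable {d : ℕ}

/-- On typical tuples the product `u` satisfies `u ^ (p - 1) ≤ exp ((p - 1) n (b + c))` and `u - t ≥
u / 2`. One factor `1/2` comes from this, the other from the typical mass. -/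
theorem le_sum_posPart_tensorPower {y : Fin d → ℝ} (hy : ∀ i, 0 ≤ y i) {B : ℝ} (hB : 0 < B)
    (hyB : ∀ i, |Real.log (y i)| ≤ B) {p b c t : ℝ} (hp : 1 ≤ p) (hZ : 0 < ∑ i, y i ^ p)
    (hb : ∑ i, y i ^ p * (Real.log (y i) - b) = 0) (hc : 0 < c) (hcB : c ≤ 2 * B) {n : ℕ}
    (hn : Real.log 4 ≤ n * (c ^ 2 / (4 * (2 * B) ^ 2)))
    (ht : 2 * t ≤ Real.exp (n * (b - c))) :
    (∑ i, y i ^ p) ^ n / 4 * Real.exp (-((p - 1) * (n * (b + c)))) ≤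
      ∑ i, max (tensorPower y n i - t) 0 := by
  have hw : ∀ i, 0 ≤ y i ^ p := fun i => Real.rpow_nonneg (hy i) p
  have hbB : |b| ≤ B := by
    have h₁ : (∑ i, y i ^ p) * b = ∑ i, y i ^ p * Real.log (y i) := by
      simp only [mul_sub, Finset.sum_sub_distrib, ← Finset.sum_mul] at hb
      linarith
    have h₂ : (∑ i, y i ^ p) * |b| ≤ (∑ i, y i ^ p) * B := by
      rw [← abs_of_pos hZ, ← abs_mul, abs_of_pos hZ, h₁, Finset.sum_mul]
      refine (Finset.abs_sum_le_sum_abs _ _).trans (Finset.sum_le_sum fun i _ => ?_)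
      rw [abs_mul, abs_of_nonneg (hw i)]
      exact mul_le_mul_of_nonneg_left (hyB i) (hw i)
    exact le_of_mul_le_mul_left h₂ hZ
  have hf : ∀ i, |Real.log (y i) - b| ≤ 2 * B := fun i =>
    (abs_sub _ _).trans (by linarith [hyB i])
  have hconc := half_le_sum_prod_filter_abs_le hw hb (by positivity) hf hc hcB hn
  set E := Real.exp (-((p - 1) * (n * (b + c)))) with hE
  have hE0 : 0 < E := Real.exp_pos _
  calc (∑ i, y i ^ p) ^ n / 4 * E = (∑ i, y i ^ p) ^ n / 2 * (E / 2) := by ring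
    _ ≤ (∑ i : Fin n → Fin d with |∑ j, (Real.log (y (i j)) - b)| ≤ n * c,
          ∏ j, y (i j) ^ p) * (E / 2) := by gcongr
    _ = ∑ i : Fin n → Fin d with |∑ j, (Real.log (y (i j)) - b)| ≤ n * c,
          (∏ j, y (i j) ^ p) * (E / 2) := Finset.sum_mul _ _ _
    _ ≤ ∑ i : Fin n → Fin d with |∑ j, (Real.log (y (i j)) - b)| ≤ n * c,
          max (tensorPower y n i - t) 0 := by
        refine Finset.sum_le_sum fun i hi => ?_
        replace hi := (Finset.mem_filter.1 hi).2
        by_cases hpos : ∀ j, 0 < y (i j)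
        · rw [← tensorPower_rpow hy]
          have hu := tensorPower_eq_exp hpos
          set u := tensorPower y n i
          rw [Finset.sum_sub_distrib, Finset.sum_const, Finset.card_univ, Fintype.card_fin,
            nsmul_eq_mul, abs_le] at hi
          set S := ∑ j, Real.log (y (i j))
          have htu : 2 * t ≤ u := by
            rw [hu]
            exact ht.trans (Real.exp_le_exp.2 (by linarith))
          have hle : u ^ p * E ≤ u := by
            rw [hu, ← Real.exp_mul, hE, ← Real.exp_add]
            refine Real.exp_le_exp.2 ?_
            nlinarith [mul_nonneg (sub_nonneg.2 hp) (show 0 ≤ n * (b + c) - S by linarith)]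
          refine le_max_of_le_left ?_
          linarith
        -- Tuples meeting a zero of `y`, where `log` takes the junk value `0`, carry no weight.
        · push Not at hpos
          obtain ⟨j, hj⟩ := hpos
          have : ∏ j, y (i j) ^ p = 0 := Finset.prod_eq_zero (Finset.mem_univ j) (by
            rw [le_antisymm hj (hy _), Real.zero_rpow (by linarith)])
          rw [this, zero_mul]
          exact le_max_right _ _
    _ ≤ _ := Finset.sum_le_univ_sum_of_nonneg fun i => le_max_right _ _

end LowerBound

/-! ### Power sums as functions of the exponent -/

section PowerSums

variable {ι : Type*} [Fintype ι]

theorem continuousOn_sum_rpow_mul {y : ι → ℝ} (c : ι → ℝ) :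
    ContinuousOn (fun p : ℝ => ∑ i, y i ^ p * c i) (Set.Ioi 0) := by
  refine continuousOn_finsetSum _ fun i _ => ContinuousOn.mul ?_ continuousOn_const
  intro p hp
  exact (Real.continuousAt_const_rpow' (ne_of_gt hp)).continuousWithinAt

theorem sum_rpow_pos {y : ι → ℝ} (hy : ∀ i, 0 ≤ y i) {k : ι} (hk : 0 < y k) (p : ℝ) :
    0 < ∑ i, y i ^ p :=
  Finset.sum_pos' (fun i _ => Real.rpow_nonneg (hy i) p)
    ⟨k, Finset.mem_univ k, Real.rpow_pos_of_pos hk p⟩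

/-- For a level below the maximum of `log ∘ y`, large exponents put most of the mass of the
weights `y ^ p` above that level. -/
theorem exists_sum_rpow_mul_log_sub_nonneg {y : ι → ℝ} (hy : ∀ i, 0 ≤ y i) {k : ι}
    (hk : 0 < y k) {a : ℝ} (ha : a < Real.log (y k)) :
    ∃ P : ℝ, 1 ≤ P ∧ 0 ≤ ∑ i, y i ^ P * (Real.log (y i) - a) := by
  classical
  set K := ∑ i, |Real.log (y i) - a| with hK
  set g := Real.log (y k) - a with hg
  have hg0 : 0 < g := sub_pos.2 ha
  have hlim : Filter.Tendsto (fun P : ℝ => Real.exp (g * P) * g) Filter.atTop Filter.atTop :=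
    (Real.tendsto_exp_atTop.comp (Filter.tendsto_id.const_mul_atTop hg0)).atTop_mul_const hg0
  obtain ⟨P, hP, hP1⟩ :=
    ((hlim.eventually_ge_atTop K).and (Filter.eventually_ge_atTop 1)).exists
  refine ⟨P, hP1, ?_⟩
  -- Terms below the level `a` cost at most a multiple of `exp (a P)`, which `y k ^ P` outgrows.
  have hterm : ∀ i, (if i = k then y k ^ P * g else 0) -
      Real.exp (a * P) * |Real.log (y i) - a| ≤ y i ^ P * (Real.log (y i) - a) := by
    intro i
    have h0 : 0 ≤ Real.exp (a * P) * |Real.log (y i) - a| := by positivity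
    split_ifs with hi
    · subst hi
      linarith
    · rcases le_or_gt a (Real.log (y i)) with h | h
      · have := mul_nonneg (Real.rpow_nonneg (hy i) P) (sub_nonneg.2 h)
        linarith
      · rcases (hy i).eq_or_lt with hz | hz
        · rw [← hz] at h0 ⊢
          rw [Real.zero_rpow (by linarith)]
          linarith
        · have h₁ : y i ^ P ≤ Real.exp (a * P) := by
            rw [Real.rpow_def_of_pos hz]
            exact Real.exp_le_exp.2 (by nlinarith)
          rw [abs_of_neg (sub_neg.2 h)]
          nlinarith [mul_le_mul_of_nonneg_right h₁ (sub_nonneg.2 h.le)]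
  have hsum := Finset.sum_le_sum fun i (_ : i ∈ Finset.univ) => hterm i
  rw [Finset.sum_sub_distrib, Finset.sum_ite_eq' Finset.univ k, if_pos (Finset.mem_univ k),
    ← Finset.mul_sum, ← hK] at hsum
  refine le_trans ?_ hsum
  have hyk : y k ^ P = Real.exp (a * P) * Real.exp (g * P) := by
    rw [Real.rpow_def_of_pos hk, ← Real.exp_add]
    congr 1
    rw [hg]
    ring
  rw [hyk, mul_assoc, ← mul_sub]
  exact mul_nonneg (Real.exp_pos _).le (sub_nonneg.2 hP)

/-- Either some exponent `p ≥ 1` centres `log ∘ y` at the given level, or the mean for the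
exponent `1` is already above that level. -/
theorem exists_rpow_mean {y : ι → ℝ} (hy : ∀ i, 0 ≤ y i) {k : ι}
    (hk : 0 < y k) {a : ℝ} (ha : a < Real.log (y k)) :
    ∃ p b : ℝ, 1 ≤ p ∧ a ≤ b ∧ (p - 1) * b = (p - 1) * a ∧
      ∑ i, y i ^ p * (Real.log (y i) - b) = 0 := by
  rcases le_or_gt 0 (∑ i, y i ^ (1 : ℝ) * (Real.log (y i) - a)) with h | h
  · have hZ := sum_rpow_pos hy hk 1
    refine ⟨1, (∑ i, y i ^ (1 : ℝ) * Real.log (y i)) / ∑ i, y i ^ (1 : ℝ), le_rfl, ?_,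
      by simp, ?_⟩
    · rw [le_div_iff₀ hZ]
      simp only [mul_sub, Finset.sum_sub_distrib, ← Finset.sum_mul] at h
      linarith
    · simp only [mul_sub, Finset.sum_sub_distrib, ← Finset.sum_mul]
      field_simp
      ring
  · obtain ⟨P, hP1, hP⟩ := exists_sum_rpow_mul_log_sub_nonneg hy hk ha
    have hcont : ContinuousOn (fun p : ℝ => ∑ i, y i ^ p * (Real.log (y i) - a))
        (Set.Icc 1 P) :=
      (continuousOn_sum_rpow_mul _).mono fun p hp => lt_of_lt_of_le one_pos hp.1
    obtain ⟨p, hp, hp0⟩ := intermediate_value_Icc hP1 hcont ⟨h.le, hP⟩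
    exact ⟨p, a, hp.1, le_rfl, rfl, hp0⟩

/-- Strict inequalities between all power sums, and between the maxima, are uniform in the
exponent. -/
theorem exists_uniform_gap {x y : ι → ℝ} (hx : ∀ i, 0 ≤ x i) (hy : ∀ i, 0 ≤ y i) {k : ι}
    (hmax : ∀ i, x i < y k) (hxy : ∀ p : ℝ, 1 ≤ p → ∑ i, x i ^ p < ∑ i, y i ^ p) :
    ∃ δ, 0 < δ ∧ (∀ i, x i ≤ y k * Real.exp (-δ)) ∧
      ∀ p : ℝ, 1 ≤ p → ∑ i, x i ^ p ≤ Real.exp (-(δ * p)) * ∑ i, y i ^ p := by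
  have hk : 0 < y k := (hx k).trans_lt (hmax k)
  -- Half of the rate `2 r` will pay for the factor `card ι` at large exponents.
  obtain ⟨r, hr0, hr⟩ : ∃ r, 0 < r ∧ ∀ i, x i ≤ y k * Real.exp (-(2 * r)) := by
    have hlim : Filter.Tendsto (fun r : ℝ => y k * Real.exp (-(2 * r)))
        (nhdsWithin 0 (Set.Ioi 0)) (nhds (y k)) := by
      have : Continuous fun r : ℝ => y k * Real.exp (-(2 * r)) := by fun_prop
      simpa using (this.tendsto 0).mono_left nhdsWithin_le_nhds
    have h₁ : ∀ᶠ r in nhdsWithin (0 : ℝ) (Set.Ioi 0), ∀ i, x i < y k * Real.exp (-(2 * r)) :=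
      Filter.eventually_all.2 fun i => hlim.eventually_const_lt (hmax i)
    obtain ⟨r, hr, hr0⟩ := (h₁.and self_mem_nhdsWithin).exists
    exact ⟨r, hr0, fun i => (hr i).le⟩
  obtain ⟨P, hP, hP1⟩ : ∃ P : ℝ, (Fintype.card ι : ℝ) ≤ Real.exp (r * P) ∧ 1 ≤ P :=
    (((Real.tendsto_exp_atTop.comp
      (Filter.tendsto_id.const_mul_atTop hr0)).eventually_ge_atTop _).and
      (Filter.eventually_ge_atTop 1)).exists
  have hlarge : ∀ p : ℝ, P ≤ p → ∑ i, x i ^ p ≤ Real.exp (-(r * p)) * ∑ i, y i ^ p := by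
    intro p hp
    have hp0 : 0 ≤ p := by linarith
    have h₁ : ∀ i, x i ^ p ≤ y k ^ p * Real.exp (-(2 * r) * p) := by
      intro i
      rw [Real.exp_mul, ← Real.mul_rpow hk.le (Real.exp_pos _).le]
      exact Real.rpow_le_rpow (hx i) (hr i) hp0
    have h₂ : y k ^ p ≤ ∑ i, y i ^ p :=
      Finset.single_le_sum (fun i _ => Real.rpow_nonneg (hy i) p) (Finset.mem_univ k)
    have h₃ : (Fintype.card ι : ℝ) ≤ Real.exp (r * p) :=
      hP.trans (Real.exp_le_exp.2 (by nlinarith))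
    calc ∑ i, x i ^ p ≤ ∑ _i : ι, y k ^ p * Real.exp (-(2 * r) * p) :=
          Finset.sum_le_sum fun i _ => h₁ i
      _ = Fintype.card ι * (y k ^ p * Real.exp (-(2 * r) * p)) := by simp
      _ ≤ Real.exp (r * p) * (y k ^ p * Real.exp (-(2 * r) * p)) := by gcongr
      _ = Real.exp (-(r * p)) * y k ^ p := by
          rw [mul_left_comm, ← Real.exp_add, mul_comm]
          congr 2
          ring
      _ ≤ _ := by gcongr
  have hpos : ∀ p : ℝ, 0 < ∑ i, y i ^ p := sum_rpow_pos hy hk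
  obtain ⟨q, hq, hqmax⟩ := isCompact_Icc.exists_isMaxOn (Set.nonempty_Icc.2 hP1)
    (f := fun p : ℝ => (∑ i, x i ^ p) / ∑ i, y i ^ p) (by
      have h : ∀ z : ι → ℝ, ContinuousOn (fun p : ℝ => ∑ i, z i ^ p) (Set.Icc 1 P) := by
        intro z
        have := continuousOn_sum_rpow_mul (y := z) fun _ => 1
        simp only [mul_one] at this
        exact this.mono fun p hp => lt_of_lt_of_le one_pos hp.1
      exact (h x).div (h y) fun p _ => (hpos p).ne')
  set ρ := (∑ i, x i ^ q) / ∑ i, y i ^ q with hρ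
  have hρ1 : ρ < 1 := (div_lt_one (hpos q)).2 (hxy q hq.1)
  obtain ⟨s, hs0, hs⟩ : ∃ s, 0 < s ∧ ρ ≤ Real.exp (-(s * P)) := by
    have hlim : Filter.Tendsto (fun s : ℝ => Real.exp (-(s * P)))
        (nhdsWithin 0 (Set.Ioi 0)) (nhds 1) := by
      have : Continuous fun s : ℝ => Real.exp (-(s * P)) := by fun_prop
      simpa using (this.tendsto 0).mono_left nhdsWithin_le_nhds
    obtain ⟨s, hs, hs0⟩ := ((hlim.eventually_const_lt hρ1).and self_mem_nhdsWithin).exists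
    exact ⟨s, hs0, hs.le⟩
  refine ⟨min r s, lt_min hr0 hs0, fun i => (hr i).trans ?_, fun p hp => ?_⟩
  · gcongr
    linarith [min_le_left r s]
  rcases le_total P p with h | h
  · refine (hlarge p h).trans ?_
    gcongr
    · exact (hpos p).le
    · exact min_le_left r s
  · have h₁ : (∑ i, x i ^ p) / ∑ i, y i ^ p ≤ Real.exp (-(min r s * p)) := by
      refine (hqmax ⟨hp, h⟩).trans (hs.trans (Real.exp_le_exp.2 (neg_le_neg ?_)))
      exact mul_le_mul (min_le_right r s) h (by linarith) hs0.le
    exact (div_le_iff₀ (hpos p)).1 h₁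

end PowerSums

/-! ### Comparison of tensor powers -/

theorem eventually_submajorized_tensorPower {d : ℕ} {x y : Fin d → ℝ} (hx : ∀ i, 0 ≤ x i)
    (hy : ∀ i, 0 ≤ y i) {k : Fin d} (hmax : ∀ i, x i < y k)
    (hxy : ∀ p : ℝ, 1 ≤ p → ∑ i, x i ^ p < ∑ i, y i ^ p) :
    ∃ n : ℕ, 1 ≤ n ∧ ∀ N : ℕ, n ≤ N → Submajorized (tensorPower x N) (tensorPower y N) := by
  have hk : 0 < y k := (hx k).trans_lt (hmax k)
  obtain ⟨δ, hδ, hxδ, hgap⟩ := exists_uniform_gap hx hy hmax hxy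
  -- The summand `δ` ensures `B > 0` and `δ / 4 ≤ 2 * B`.
  set B := ∑ i, |Real.log (y i)| + δ with hBdef
  have hB : 0 < B := add_pos_of_nonneg_of_pos (Finset.sum_nonneg fun i _ => abs_nonneg _) hδ
  have hδB : δ ≤ B := le_add_of_nonneg_left (Finset.sum_nonneg fun i _ => abs_nonneg _)
  have hyB : ∀ i, |Real.log (y i)| ≤ B := fun i =>
    (Finset.single_le_sum (f := fun i => |Real.log (y i)|) (fun i _ => abs_nonneg _)
      (Finset.mem_univ i)).trans (by linarith)
  have hq : 0 < (δ / 4) ^ 2 / (4 * (2 * B) ^ 2) := by positivity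
  obtain ⟨n₁, hn₁⟩ := exists_nat_ge (Real.log 4 / ((δ / 4) ^ 2 / (4 * (2 * B) ^ 2)))
  obtain ⟨n₂, hn₂⟩ := exists_nat_ge (Real.log 4 / (δ / 4))
  rw [div_le_iff₀ hq] at hn₁
  rw [div_le_iff₀ (by positivity)] at hn₂
  refine ⟨max 1 (max n₁ n₂), le_max_left _ _, fun N hN => ?_⟩
  simp only [max_le_iff] at hN
  obtain ⟨hN1, hNn₁, hNn₂⟩ := hN
  have hN0 : (0 : ℝ) < N := by exact_mod_cast hN1
  have hN₁ : Real.log 4 ≤ N * ((δ / 4) ^ 2 / (4 * (2 * B) ^ 2)) :=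
    hn₁.trans (by gcongr)
  have hN₂ : Real.log 4 ≤ N * (δ / 4) := hn₂.trans (by gcongr)
  refine submajorized_of_sum_posPart_le (tensorPower_nonneg hy N) fun t ht => ?_
  rcases ht.eq_or_lt with rfl | ht
  · have h : ∀ {z : Fin d → ℝ}, (∀ i, 0 ≤ z i) →
        ∑ i, max (tensorPower z N i - 0) 0 = (∑ i, z i ^ (1 : ℝ)) ^ N := by
      intro z hz
      rw [← sum_tensorPower_rpow hz]
      refine Finset.sum_congr rfl fun i _ => ?_
      rw [sub_zero, max_eq_left (tensorPower_nonneg hz N i), Real.rpow_one]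
    rw [h hx, h hy]
    exact pow_le_pow_left₀ (Finset.sum_nonneg fun i _ => Real.rpow_nonneg (hx i) 1)
      (hxy 1 le_rfl).le N
  obtain ⟨a, rfl⟩ : ∃ a, t = Real.exp (N * a) :=
    ⟨Real.log t / N, by rw [mul_div_cancel₀ _ hN0.ne', Real.exp_log ht]⟩
  -- Above this level no product from `x` exceeds `t`; below it the tilted mean can be placed at `a
  -- + δ / 2`.
  rcases le_or_gt (Real.log (y k) - δ) a with ha | ha
  · have h : ∀ i, max (tensorPower x N i - Real.exp (N * a)) 0 = 0 := by
      intro i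
      refine max_eq_right (sub_nonpos.2 ?_)
      calc tensorPower x N i ≤ ∏ _j : Fin N, Real.exp a := by
            refine Finset.prod_le_prod (fun j _ => hx _) fun j _ => (hxδ _).trans ?_
            rw [← Real.exp_log hk, ← Real.exp_add]
            exact Real.exp_le_exp.2 (by linarith)
        _ = Real.exp (N * a) := by simp [Real.exp_nat_mul]
    simp only [h, Finset.sum_const_zero]
    exact Finset.sum_nonneg fun i _ => le_max_right _ _
  obtain ⟨p, b, hp, hab, hpb, hb⟩ :=
    exists_rpow_mean hy hk (show a + δ / 2 < Real.log (y k) by linarith)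
  have hZ := sum_rpow_pos hy hk p
  have hlog4 : Real.log 4 = 2 * Real.log 2 := by
    rw [show (4 : ℝ) = 2 ^ 2 by norm_num, Real.log_pow]
    norm_num
  have hlog2 : 0 < Real.log 2 := Real.log_pos one_lt_two
  have hlower := le_sum_posPart_tensorPower hy hB hyB hp hZ hb (c := δ / 4)
    (t := Real.exp (N * a)) (by positivity) (by linarith) hN₁ (by
      rw [← Real.exp_log (two_pos : (0 : ℝ) < 2), ← Real.exp_add]
      refine Real.exp_le_exp.2 ?_
      nlinarith [mul_le_mul_of_nonneg_left hab hN0.le])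
  refine ((sum_posPart_tensorPower_le hx N hp ht).trans ?_).trans hlower
  have hxZ : (∑ i, x i ^ p) ^ N ≤ (Real.exp (-(δ * p)) * ∑ i, y i ^ p) ^ N :=
    pow_le_pow_left₀ (Finset.sum_nonneg fun i _ => Real.rpow_nonneg (hx i) p) (hgap p hp) N
  have hfour : Real.exp (N * -(δ * p) + N * a * (1 - p)) ≤
      Real.exp (-Real.log 4 + -((p - 1) * (N * (b + δ / 4)))) := by
    refine Real.exp_le_exp.2 ?_
    -- Either `p = 1` or `b = a + δ / 2`. The loss `(p - 1) * 3δ/4` per factor leaves at least `δ /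
    -- 4` of the gap `δ p`, enough for `log 4`.
    have h₁ : (p - 1) * (N * (b + δ / 4)) = N * ((p - 1) * (a + 3 * δ / 4)) := by
      linear_combination N * hpb
    have h₂ : N * (δ / 4) ≤ N * (δ / 4 * p) := by
      gcongr
      nlinarith
    rw [h₁]
    nlinarith [mul_pos hN0 hδ]
  calc (∑ i, x i ^ p) ^ N * Real.exp (N * a) ^ (1 - p)
      ≤ (Real.exp (-(δ * p)) * ∑ i, y i ^ p) ^ N * Real.exp (N * a) ^ (1 - p) := by gcongr
    _ = (∑ i, y i ^ p) ^ N * Real.exp (N * -(δ * p) + N * a * (1 - p)) := by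
        rw [mul_pow, ← Real.exp_nat_mul, ← Real.exp_mul, Real.exp_add]
        ring
    _ ≤ (∑ i, y i ^ p) ^ N * Real.exp (-Real.log 4 + -((p - 1) * (N * (b + δ / 4)))) := by
        gcongr
    _ = _ := by
        rw [Real.exp_add, Real.exp_neg (Real.log 4), Real.exp_log (by norm_num)]
        ring

theorem sum_rpow_lt_of_norm_toLp_lt {ι : Type*} [Fintype ι] {x y : ι → ℝ} (hx : ∀ i, 0 ≤ x i)
    (hy : ∀ i, 0 ≤ y i) {p : ℝ} (hp : 0 < p)
    (h : ‖(WithLp.toLp (ENNReal.ofReal p) x : PiLp (ENNReal.ofReal p) fun _ : ι => ℝ)‖ <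
      ‖(WithLp.toLp (ENNReal.ofReal p) y : PiLp (ENNReal.ofReal p) fun _ : ι => ℝ)‖) :
    ∑ i, x i ^ p < ∑ i, y i ^ p := by
  have hp' : (ENNReal.ofReal p).toReal = p := ENNReal.toReal_ofReal hp.le
  rw [PiLp.norm_eq_sum (by rwa [hp']), PiLp.norm_eq_sum (by rwa [hp'])] at h
  simp only [hp', Real.norm_of_nonneg (hx _), Real.norm_of_nonneg (hy _)] at h
  exact (Real.rpow_lt_rpow_iff (Finset.sum_nonneg fun i _ => Real.rpow_nonneg (hx i) p)
    (Finset.sum_nonneg fun i _ => Real.rpow_nonneg (hy i) p) (by positivity)).1 h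

theorem exists_forall_lt_of_norm_toLp_top_lt {ι : Type*} [Fintype ι] {x y : ι → ℝ}
    (hx : ∀ i, 0 ≤ x i) (hy : ∀ i, 0 ≤ y i)
    (h : ‖(WithLp.toLp ⊤ x : PiLp ⊤ fun _ : ι => ℝ)‖ <
      ‖(WithLp.toLp ⊤ y : PiLp ⊤ fun _ : ι => ℝ)‖) :
    ∃ k, ∀ i, x i < y k := by
  rw [PiLp.norm_eq_ciSup, PiLp.norm_eq_ciSup] at h
  simp only [Real.norm_of_nonneg (hx _), Real.norm_of_nonneg (hy _)] at h
  cases isEmpty_or_nonempty ι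
  · simp at h
  · obtain ⟨k, hk⟩ := exists_lt_of_lt_ciSup h
    exact ⟨k, fun i => (le_ciSup (Set.finite_range x).bddAbove i).trans_lt hk⟩

theorem lemma2 (d : ℕ) (x y : Fin d → ℝ) (hx : ∀ i, 0 ≤ x i) (hy : ∀ i, 0 ≤ y i)
    (hxy : ∀ p : ℝ≥0∞, 1 ≤ p →
      ‖(WithLp.toLp p x : PiLp p (fun _ : Fin d => ℝ))‖ <
        ‖(WithLp.toLp p y : PiLp p (fun _ : Fin d => ℝ))‖) :
    ∃ n : ℕ, 1 ≤ n ∧ ∀ N : ℕ, n ≤ N →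
      Submajorized (tensorPower x N) (tensorPower y N) := by
  obtain ⟨k, hk⟩ := exists_forall_lt_of_norm_toLp_top_lt hx hy (hxy ⊤ le_top)
  exact eventually_submajorized_tensorPower hx hy hk fun p hp =>
    sum_rpow_lt_of_norm_toLp_lt hx hy (by linarith) (hxy _ (ENNReal.one_le_ofReal.2 hp))
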